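/- Let $n\ge 0$ be an integer and let $\omega\in(0,(n+1)\pi)$. Let $\mathcal U_n$ be the set of rational functions $r=p/q$, where $p,q$ are complex polynomials of degree at most $n$ with $q\neq 0$, that are unitary, i.e. $|r(\mathrm i x)|=1$ for all $x\in\mathbb R$. Write $\|f\|=\max_{x\in[-1,1]}|f(\mathrm i x)|$. Then there is exactly one $\widetilde r\in\mathcal U_n$ with $$\|\widetilde r-\exp(\omega\,\cdot)\|=\min_{r\in\mathcal U_n}\|r-\exp(\omega\,\cdot)\|,$$ the unitary best approximant. Moreover, if $(r_j)_{j\in\mathbb N}$ is a sequence in $\mathcal U_n$ with $$\|r_j-\exp(\omega\,\cdot)\|\to\|\widetilde r-\exp(\omega\,\cdot)\|\qquad\text{for } j\to\infty,$$ then $$\|r_j-\widetilde r\|\to 0\qquad\text{for } j\to\infty.$$ -/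

import Mathlib

open Polynomial Filter Topology

noncomputable section

/-- The value `r(z)` of a rational function (in lowest terms, so that removable singularities
are removed). At a pole the value is `0`. -/
def ratVal (r : RatFunc ℂ) (z : ℂ) : ℂ := r.eval (RingHom.id ℂ) z

/-- `(n,n)`-rational functions: quotients `p / q` of polynomials of degree at most `n`. -/
def IsRationalNN (n : ℕ) (r : RatFunc ℂ) : Prop :=
  ∃ p q : ℂ[X], p.natDegree ≤ n ∧ q.natDegree ≤ n ∧ q ≠ 0 ∧
    r = algebraMap ℂ[X] (RatFunc ℂ) p / algebraMap ℂ[X] (RatFunc ℂ) q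

/-- `r` is unitary if `|r(ix)| = 1` for all real `x`. Since the value at a pole is `0`, this
includes that `r` has no pole on the imaginary axis. -/
def IsUnitaryRational (r : RatFunc ℂ) : Prop :=
  ∀ x : ℝ, ‖ratVal r (Complex.I * x)‖ = 1

/-- The class of unitary `(n,n)`-rational functions. -/
def unitaryClass (n : ℕ) : Set (RatFunc ℂ) :=
  {r | IsRationalNN n r ∧ IsUnitaryRational r}

/-- The uniform norm on `i[-1,1]`, the maximum of `|f(ix)|` over `x ∈ [-1,1]`; it is used only for
functions that are continuous on `i[-1,1]`, for which the supremum is attained. -/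
def imagNorm (f : ℂ → ℂ) : ℝ :=
  sSup ((fun x : ℝ => ‖f (Complex.I * x)‖) '' Set.Icc (-1) 1)

/-- The uniform error `‖r - exp(ω ·)‖`. -/
def expError (ω : ℝ) (r : RatFunc ℂ) : ℝ :=
  imagNorm (fun z => ratVal r z - Complex.exp (ω * z))

/-- `r` is a unitary best approximant of degree `n` to `exp(ω ·)`. -/
def IsUnitaryBestApproximant (n : ℕ) (ω : ℝ) (r : RatFunc ℂ) : Prop :=
  r ∈ unitaryClass n ∧ ∀ s ∈ unitaryClass n, expError ω r ≤ expError ω s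

end

/-! On the imaginary axis a unitary function is `conj Q / Q` with `deg Q ≤ n`. Writing `u =
exp(iωx/2) Q(x)`, the error at `ix` is `2|sin arg u|`. Hence, up to the sign of `Q`, an error of at
most `E < 2` means `|Im u| ≤ τ Re u` with `τ = tan (arcsin (E/2))`. This `ErrorCone` is convex in
`Q`, which linearizes the problem.

The assumption `ω < (n+1)π` provides some `Q` with `Re u > 0` (`exists_rotVal_re_pos`), so a finite
level exists and compactness yields a minimal one. A minimizer coprime to its conjugate touches the
boundary of its cone at no fewer than `n + deg Q + 2` points, since otherwise an interpolation
argument improves it (`le_card_extremal`). It touches at no more than `2 deg Q + 2` points, because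
the phase derivative has at most `2 deg Q` zeros (`exists_extremal_finset`). So `deg Q = n`, and no
minimizer has a nonconstant real factor.

If `P` and `Q` are minimizers, so is `P + Q`. At each of its at least `2n+2` extremal points `P` and
`Q` have the same phase, so `Im (P conj Q)`, of degree at most `2n`, vanishes identically and `Q` is
a real multiple of `P` (`eq_C_mul_of_isMinimalLevel`). Uniqueness and compactness of normalized
coefficients then give the convergence (`exists_delta_of_isMinimalLevel`). -/

/-! ### Conjugate polynomials and real factors -/

/-- The polynomial with conjugated coefficients. -/
noncomputable def conjPoly (Q : ℂ[X]) : ℂ[X] := Q.map (starRingEnd ℂ)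

lemma conjPoly_eval_ofReal (Q : ℂ[X]) (x : ℝ) :
    (conjPoly Q).eval (x : ℂ) = starRingEnd ℂ (Q.eval (x : ℂ)) := by
  have h := Polynomial.eval_map_apply (p := Q) (starRingEnd ℂ) (x : ℂ)
  rw [Complex.conj_ofReal] at h
  exact h

lemma conjPoly_conjPoly (Q : ℂ[X]) : conjPoly (conjPoly Q) = Q := by
  ext k; simp [conjPoly]

lemma natDegree_conjPoly (Q : ℂ[X]) : (conjPoly Q).natDegree = Q.natDegree :=
  Polynomial.natDegree_map _

lemma degree_conjPoly (Q : ℂ[X]) : (conjPoly Q).degree = Q.degree :=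
  Polynomial.degree_map _ _

lemma conjPoly_mul (P Q : ℂ[X]) : conjPoly (P * Q) = conjPoly P * conjPoly Q :=
  Polynomial.map_mul _

lemma conjPoly_ne_zero {Q : ℂ[X]} (h : Q ≠ 0) : conjPoly Q ≠ 0 := by
  intro h'; apply h; rw [← conjPoly_conjPoly Q, h']; simp [conjPoly]

lemma conjPoly_C (c : ℂ) : conjPoly (C c) = C (starRingEnd ℂ c) := Polynomial.map_C _

lemma conjPoly_map_ofReal (D : ℝ[X]) :
    conjPoly (D.map (algebraMap ℝ ℂ)) = D.map (algebraMap ℝ ℂ) := by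
  ext k; simp [conjPoly]

lemma eval_map_ofReal (D : ℝ[X]) (x : ℝ) :
    (D.map (algebraMap ℝ ℂ)).eval (x : ℂ) = (D.eval x : ℝ) := by
  have := Polynomial.eval_map_apply (p := D) (algebraMap ℝ ℂ) x
  simpa using this

/-- Complex polynomials that agree on the real line are equal. -/
lemma eq_of_forall_real_eval {P Q : ℂ[X]} (h : ∀ x : ℝ, P.eval (x : ℂ) = Q.eval (x : ℂ)) :
    P = Q := by
  apply Polynomial.eq_of_infinite_eval_eq
  refine Set.Infinite.mono (s := Set.range (fun x : ℝ => (x : ℂ))) ?_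
    (Set.infinite_range_of_injective Complex.ofReal_injective)
  rintro _ ⟨x, rfl⟩
  exact h x

lemma conjPoly_eval_conj (Q : ℂ[X]) (z : ℂ) :
    (conjPoly Q).eval z = starRingEnd ℂ (Q.eval (starRingEnd ℂ z)) := by
  have h := Polynomial.eval_map_apply (p := Q) (starRingEnd ℂ) (starRingEnd ℂ z)
  rw [Complex.conj_conj] at h
  exact h

lemma eval_ne_zero_of_isCoprime {Q : ℂ[X]} (h : IsCoprime Q (conjPoly Q)) (x : ℝ) :
    Q.eval (x : ℂ) ≠ 0 := by
  intro h0
  obtain ⟨u, v, huv⟩ := h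
  have := congrArg (Polynomial.eval (x : ℂ)) huv
  simp [conjPoly_eval_ofReal, h0] at this

/-- Every nonzero complex polynomial is the product of a real polynomial and a polynomial that is
coprime to its conjugate. -/
lemma exists_real_mul_coprime (Q : ℂ[X]) (hQ : Q ≠ 0) :
    ∃ (D : ℝ[X]) (P : ℂ[X]), Q = D.map (algebraMap ℝ ℂ) * P ∧ IsCoprime P (conjPoly P) := by
  induction hd : Q.natDegree using Nat.strong_induction_on generalizing Q with
  | _ d ih =>
  by_cases hc : IsCoprime Q (conjPoly Q)
  · exact ⟨1, Q, by simp, hc⟩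
  -- A common root `z` of `Q` and its conjugate makes both `z` and `conj z` roots of `Q`, so a real
  -- factor of degree 1 or 2 splits off.
  have key : ∃ (D : ℝ[X]) (P : ℂ[X]), 0 < D.natDegree ∧ Q = D.map (algebraMap ℝ ℂ) * P := by
    have : ∃ z, Q.eval z = 0 ∧ (conjPoly Q).eval z = 0 := by
      by_contra hne
      push Not at hne
      apply hc
      apply isCoprime_of_dvd
      · intro h; exact hQ h.1
      · intro z hz hz0 h1 h2
        obtain ⟨w, hw⟩ := IsAlgClosed.exists_root z (by
          intro h0
          exact hz (Polynomial.isUnit_iff_degree_eq_zero.2 h0))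
        exact hne w (Polynomial.eval_eq_zero_of_dvd_of_eval_eq_zero h1 hw)
          (Polynomial.eval_eq_zero_of_dvd_of_eval_eq_zero h2 hw)
    obtain ⟨z, h1, h2⟩ := this
    rw [conjPoly_eval_conj, map_eq_zero] at h2
    by_cases hz : z.im = 0
    · obtain ⟨P, hP⟩ := Polynomial.dvd_iff_isRoot.2 h1
      refine ⟨X - C z.re, P, by simp, ?_⟩
      rw [hP]
      have : ((z.re : ℝ) : ℂ) = z := by apply Complex.ext <;> simp [hz]
      simp [this]
    · have hne : z ≠ starRingEnd ℂ z := by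
        intro h
        exact hz (Complex.conj_eq_iff_im.1 h.symm)
      have hcop : IsCoprime (X - C z) (X - C (starRingEnd ℂ z)) :=
        Polynomial.isCoprime_X_sub_C_of_isUnit_sub (sub_ne_zero.2 hne).isUnit
      obtain ⟨P, hP⟩ := hcop.mul_dvd (Polynomial.dvd_iff_isRoot.2 h1)
        (Polynomial.dvd_iff_isRoot.2 h2)
      refine ⟨X ^ 2 + (-C (2 * z.re) * X + C (Complex.normSq z)), P, ?_, ?_⟩
      · have : (X ^ 2 + (-C (2 * z.re) * X + C (Complex.normSq z))).natDegree = 2 := by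
          compute_degree!
        omega
      · rw [hP]
        congr 1
        have e1 : (z : ℂ) + starRingEnd ℂ z = (2 * z.re : ℝ) := Complex.add_conj z
        have e2 : z * starRingEnd ℂ z = (Complex.normSq z : ℝ) := Complex.mul_conj z
        simp only [Polynomial.map_add, Polynomial.map_mul, Polynomial.map_pow, Polynomial.map_X,
          Polynomial.map_neg, Polynomial.map_C, Complex.coe_algebraMap]
        rw [← e1, ← e2, C_add, C_mul]
        ring
  obtain ⟨D, P, hD, hQP⟩ := key
  have hP : P ≠ 0 := by rintro rfl; simp at hQP; exact hQ hQP
  have hD0 : D.map (algebraMap ℝ ℂ) ≠ 0 := by rintro h0; rw [h0] at hQP; simp at hQP; exact hQ hQP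
  have hlt : P.natDegree < d := by
    rw [← hd, hQP, Polynomial.natDegree_mul hD0 hP, Polynomial.natDegree_map]
    omega
  obtain ⟨D', P', h1, h2⟩ := ih _ hlt P hP rfl
  exact ⟨D * D', P', by rw [hQP, h1, Polynomial.map_mul, mul_assoc], h2⟩

/-- For `Q` coprime to its conjugate, every real polynomial of degree at most `n + deg Q` is
`Im (H conj Q)` on the real line for some `H` of degree at most `n`. -/
lemma exists_im_mul_conj_eq {n : ℕ} {Q : ℂ[X]} (hc : IsCoprime Q (conjPoly Q))
    (hn : Q.natDegree ≤ n) (S : ℝ[X]) (hS : S.natDegree ≤ n + Q.natDegree) :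
    ∃ H : ℂ[X], H.natDegree ≤ n ∧
      ∀ x : ℝ, (H.eval (x : ℂ) * starRingEnd ℂ (Q.eval (x : ℂ))).im = S.eval x := by
  have hQ0 : Q ≠ 0 := by
    rintro rfl
    simpa using eval_ne_zero_of_isCoprime hc 0
  obtain ⟨U, V, hUV⟩ := hc
  set S' : ℂ[X] := C (2 * Complex.I) * S.map (algebraMap ℝ ℂ) with hS'
  have hS'd : S'.natDegree ≤ n + Q.natDegree :=
    (Polynomial.natDegree_C_mul_le _ _).trans (by rwa [Polynomial.natDegree_map])
  -- Bézout gives `A conj Q + B Q = 2iS`; reducing `A` modulo `Q` forces `deg B ≤ n`. On the real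
  -- line `Im (B Q) = -Im (conj B conj Q)`, so `H = (A - conj B)/2` merges both terms.
  set A := (V * S') % Q with hA
  set B := U * S' + (V * S') / Q * conjPoly Q with hB
  have hAB : A * conjPoly Q + B * Q = S' := by
    have := EuclideanDomain.div_add_mod (V * S') Q
    have h1 : A = V * S' - Q * ((V * S') / Q) := eq_sub_of_add_eq' this
    rw [h1, hB]
    linear_combination S' * hUV
  have hAd : A.natDegree ≤ Q.natDegree :=
    Polynomial.natDegree_le_natDegree (Polynomial.degree_mod_lt _ hQ0).le
  have hBd : B.natDegree ≤ n := by
    by_cases hB0 : B = 0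
    · simp [hB0]
    have h1 : (B * Q).natDegree ≤ n + Q.natDegree := by
      rw [show B * Q = S' - A * conjPoly Q by rw [← hAB]; ring]
      refine (Polynomial.natDegree_sub_le _ _).trans (max_le hS'd ?_)
      refine Polynomial.natDegree_mul_le.trans ?_
      rw [natDegree_conjPoly]; omega
    rw [Polynomial.natDegree_mul hB0 hQ0] at h1
    omega
  refine ⟨C (1 / 2) * (A - conjPoly B), ?_, ?_⟩
  · refine (Polynomial.natDegree_C_mul_le _ _).trans
      ((Polynomial.natDegree_sub_le _ _).trans (max_le (hAd.trans hn) ?_))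
    rwa [natDegree_conjPoly]
  · intro x
    have h1 := congrArg (Polynomial.eval (x : ℂ)) hAB
    simp only [hS', eval_add, eval_mul, eval_C, conjPoly_eval_ofReal, eval_map_ofReal] at h1
    simp only [eval_sub, eval_mul, eval_C, conjPoly_eval_ofReal]
    have h2 := congrArg Complex.im h1
    simp at h2
    simp
    linarith

lemma natDegree_of_im_mul_conj {P Q : ℂ[X]} {n : ℕ} (hP : P.natDegree ≤ n)
    (hQ : Q.natDegree ≤ n) : (P * conjPoly Q - conjPoly P * Q).natDegree ≤ 2 * n := by
  refine (Polynomial.natDegree_sub_le _ _).trans (max_le ?_ ?_)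
  all_goals
    refine Polynomial.natDegree_mul_le.trans ?_
    rw [natDegree_conjPoly]; omega

/-- Turns agreement of phases modulo `π` into the vanishing of a polynomial, whose real zeros can be
counted. -/
lemma eval_im_mul_conj (P Q : ℂ[X]) (x : ℝ) :
    (P * conjPoly Q - conjPoly P * Q).eval (x : ℂ) =
      2 * Complex.I * ((P.eval (x : ℂ) * starRingEnd ℂ (Q.eval (x : ℂ))).im : ℝ) := by
  simp only [eval_sub, eval_mul, conjPoly_eval_ofReal]
  apply Complex.ext
  · simp
  · simp; ring

/-- On a compact set, a nonnegative continuous function becomes positive after adding a small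
multiple of a continuous function that is positive on its zero set. -/
lemma exists_pos_add_mul {K : Set ℝ} (hK : IsCompact K) {f g : ℝ → ℝ} (hf : Continuous f)
    (hg : Continuous g) (h0 : ∀ x ∈ K, 0 ≤ f x) (h1 : ∀ x ∈ K, f x = 0 → 0 < g x) :
    ∃ ε₀ > 0, ∀ ε, 0 < ε → ε < ε₀ → ∀ x ∈ K, 0 < f x + ε * g x := by
  have hK' : IsCompact (K ∩ {x | g x ≤ 0}) := hK.inter_right (isClosed_le hg continuous_const)
  obtain ⟨M, hM⟩ := hK.exists_bound_of_continuousOn hg.continuousOn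
  -- Where `g ≤ 0` the function `f` cannot vanish, so compactness bounds it below there; elsewhere
  -- every `ε > 0` works.
  obtain ⟨c, hc, hcf⟩ : ∃ c > 0, ∀ x ∈ K ∩ {x | g x ≤ 0}, c ≤ f x := by
    rcases (K ∩ {x | g x ≤ 0}).eq_empty_or_nonempty with he | hne
    · exact ⟨1, one_pos, by simp [he]⟩
    · obtain ⟨x, hx, hmin⟩ := hK'.exists_isMinOn hne hf.continuousOn
      refine ⟨f x, lt_of_le_of_ne (h0 x hx.1) ?_, fun y hy => hmin hy⟩
      intro h
      exact absurd (h1 x hx.1 h.symm) (not_lt.2 hx.2)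
  refine ⟨c / (|M| + 1), by positivity, fun ε hε hε' x hx => ?_⟩
  rcases lt_or_ge 0 (g x) with hgx | hgx
  · have := mul_pos hε hgx
    linarith [h0 x hx]
  · have h2 := hcf x ⟨hx, hgx⟩
    have h3 := hM x hx
    rw [Real.norm_eq_abs] at h3
    have h4 := neg_le_of_abs_le h3
    have h5 : ε * (|M| + 1) < c := (lt_div_iff₀ (by positivity)).1 hε'
    have h6 : -(|M| + 1) ≤ g x := by linarith [le_abs_self M]
    nlinarith

/-! ### The rotated values and the error cone -/

/-- The value `exp(iωx/2) Q(x)`. For a polynomial `Q` without zero at `x ∈ ℝ`, its imaginary part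
governs the distance between `conj Q(x) / Q(x)` and `exp(iωx)`. -/
noncomputable def rotVal (ω : ℝ) (Q : ℂ[X]) (x : ℝ) : ℂ :=
  Complex.exp (((ω * x / 2 : ℝ) : ℂ) * Complex.I) * Q.eval (x : ℂ)

/-- `|Im (exp(iωx/2) Q(x))| ≤ τ Re (exp(iωx/2) Q(x))` on `[-1,1]`. -/
def ErrorCone (ω τ : ℝ) (Q : ℂ[X]) : Prop :=
  ∀ x ∈ Set.Icc (-1 : ℝ) 1, |(rotVal ω Q x).im| ≤ τ * (rotVal ω Q x).re

/-- No smaller error level than `τ` is attained by a nonzero polynomial of degree at most `n`. -/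
def IsMinimalLevel (n : ℕ) (ω τ : ℝ) : Prop :=
  ∀ τ', 0 ≤ τ' → τ' < τ → ∀ Q : ℂ[X], Q.natDegree ≤ n → ErrorCone ω τ' Q → Q = 0

lemma rotVal_eq_zero_iff {ω : ℝ} {Q : ℂ[X]} {x : ℝ} : rotVal ω Q x = 0 ↔ Q.eval (x : ℂ) = 0 := by
  simp [rotVal, Complex.exp_ne_zero]

lemma norm_rotVal (ω : ℝ) (Q : ℂ[X]) (x : ℝ) : ‖rotVal ω Q x‖ = ‖Q.eval (x : ℂ)‖ := by
  rw [rotVal, norm_mul, Complex.norm_exp_ofReal_mul_I, one_mul]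

lemma rotVal_add (ω : ℝ) (P Q : ℂ[X]) (x : ℝ) :
    rotVal ω (P + Q) x = rotVal ω P x + rotVal ω Q x := by
  simp [rotVal, mul_add]

lemma rotVal_real_mul (ω : ℝ) (D : ℝ[X]) (Q : ℂ[X]) (x : ℝ) :
    rotVal ω (D.map (algebraMap ℝ ℂ) * Q) x = (D.eval x : ℝ) * rotVal ω Q x := by
  simp only [rotVal, eval_mul, eval_map_ofReal]; ring

lemma rotVal_ofReal_mul (ω : ℝ) (c : ℝ) (Q : ℂ[X]) (x : ℝ) :
    rotVal ω (C (c : ℂ) * Q) x = c * rotVal ω Q x := by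
  simp only [rotVal, eval_mul, eval_C]; ring

lemma rotVal_neg (ω : ℝ) (Q : ℂ[X]) (x : ℝ) : rotVal ω (-Q) x = -rotVal ω Q x := by
  simp [rotVal]

lemma continuous_rotVal (ω : ℝ) (Q : ℂ[X]) : Continuous (rotVal ω Q) := by
  unfold rotVal
  have := Q.continuous
  fun_prop

/-- The unimodular rotation cancels, so relative phases of two polynomials can be read off from
their rotated values. -/
lemma rotVal_mul_conj (ω : ℝ) (P Q : ℂ[X]) (x : ℝ) :
    rotVal ω P x * starRingEnd ℂ (rotVal ω Q x) =
      P.eval (x : ℂ) * starRingEnd ℂ (Q.eval (x : ℂ)) := by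
  simp only [rotVal, map_mul]
  have : Complex.exp (((ω * x / 2 : ℝ) : ℂ) * Complex.I) *
      starRingEnd ℂ (Complex.exp (((ω * x / 2 : ℝ) : ℂ) * Complex.I)) = 1 := by
    rw [Complex.mul_conj, Complex.normSq_eq_norm_sq, Complex.norm_exp_ofReal_mul_I]; simp
  linear_combination (P.eval (x : ℂ) * starRingEnd ℂ (Q.eval (x : ℂ))) * this

lemma im_mul_conj_eq (ω : ℝ) (P Q : ℂ[X]) (x : ℝ) :
    (P.eval (x : ℂ) * starRingEnd ℂ (Q.eval (x : ℂ))).im =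
      (rotVal ω P x).im * (rotVal ω Q x).re - (rotVal ω P x).re * (rotVal ω Q x).im := by
  rw [← rotVal_mul_conj ω, Complex.mul_im, Complex.conj_re, Complex.conj_im]; ring

lemma hasDerivAt_rotVal (ω : ℝ) (Q : ℂ[X]) (x : ℝ) :
    HasDerivAt (rotVal ω Q)
      (rotVal ω (C ((ω / 2 : ℝ) * Complex.I) * Q + derivative Q) x) x := by
  have h1 : HasDerivAt (fun x : ℝ => Q.eval (x : ℂ)) (Q.derivative.eval (x : ℂ)) x :=
    (Q.hasDerivAt (x : ℂ)).comp_ofReal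
  have h2 : HasDerivAt (fun x : ℝ => (((ω * x / 2 : ℝ) : ℂ) * Complex.I))
      ((ω / 2 : ℝ) * Complex.I) x := by
    have h3 : HasDerivAt (fun x : ℝ => ω * x / 2) (ω / 2) x := by
      simpa using ((hasDerivAt_id x).const_mul ω).div_const 2
    exact h3.ofReal_comp.mul_const _
  refine (h2.cexp.mul h1).congr_deriv ?_
  simp only [rotVal, eval_add, eval_mul, eval_C]
  ring

lemma ErrorCone.re_nonneg {ω τ : ℝ} {Q : ℂ[X]} (h : ErrorCone ω τ Q) (hτ : 0 < τ)
    {x : ℝ} (hx : x ∈ Set.Icc (-1 : ℝ) 1) : 0 ≤ (rotVal ω Q x).re :=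
  nonneg_of_mul_nonneg_right ((abs_nonneg _).trans (h x hx)) hτ

lemma ErrorCone.re_pos {ω τ : ℝ} {Q : ℂ[X]} (h : ErrorCone ω τ Q) (hτ : 0 < τ)
    {x : ℝ} (h0 : Q.eval (x : ℂ) ≠ 0) (hx : x ∈ Set.Icc (-1 : ℝ) 1) :
    0 < (rotVal ω Q x).re := by
  refine lt_of_le_of_ne (h.re_nonneg hτ hx) fun h2 => h0 ?_
  have h1 := h x hx
  rw [← h2, mul_zero] at h1
  exact rotVal_eq_zero_iff.1 (Complex.ext h2.symm (abs_nonpos_iff.1 h1))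

/-- At an interior point where the error level is attained, the derivative of the phase vanishes. -/
lemma im_deriv_mul_conj_eq_zero {ω τ : ℝ} {Q : ℂ[X]} (h : ErrorCone ω τ Q) {x : ℝ}
    (hx : x ∈ Set.Ioo (-1 : ℝ) 1) (hE : |(rotVal ω Q x).im| = τ * (rotVal ω Q x).re) :
    ((C ((ω / 2 : ℝ) * Complex.I) * Q + derivative Q).eval (x : ℂ) *
      starRingEnd ℂ (Q.eval (x : ℂ))).im = 0 := by
  have hd := hasDerivAt_rotVal ω Q x
  have hre : HasDerivAt (fun y => (rotVal ω Q y).re) _ x :=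
    Complex.reCLM.hasFDerivAt.comp_hasDerivAt x hd
  have him : HasDerivAt (fun y => (rotVal ω Q y).im) _ x :=
    Complex.imCLM.hasFDerivAt.comp_hasDerivAt x hd
  simp only [Complex.reCLM_apply, Complex.imCLM_apply] at hre him
  have hnhds : Set.Icc (-1 : ℝ) 1 ∈ 𝓝 x := Icc_mem_nhds hx.1 hx.2
  rw [im_mul_conj_eq ω]
  rcases abs_choice (rotVal ω Q x).im with hc | hc
  · rw [hc] at hE
    -- The cone makes this function nonnegative, and it is zero at `x`.
    have hmin : IsLocalMin (fun y => τ * (rotVal ω Q y).re - (rotVal ω Q y).im) x := by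
      filter_upwards [hnhds] with y hy
      have := h y hy
      have := le_abs_self (rotVal ω Q y).im
      linarith
    have := hmin.hasDerivAt_eq_zero ((hre.const_mul τ).sub him)
    rw [hE]
    linear_combination -(rotVal ω Q x).re * this
  · rw [hc] at hE
    have hmin : IsLocalMin (fun y => τ * (rotVal ω Q y).re + (rotVal ω Q y).im) x := by
      filter_upwards [hnhds] with y hy
      have := h y hy
      have := neg_abs_le (rotVal ω Q y).im
      linarith
    have := hmin.hasDerivAt_eq_zero ((hre.const_mul τ).add him)
    rw [neg_eq_iff_eq_neg.1 hE]
    linear_combination (rotVal ω Q x).re * this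

/-! ### Counting extremal points -/

/-- The points at which the error level is attained are at most `2 deg Q + 2` many. -/
lemma exists_extremal_finset {ω τ : ℝ} (hω : ω ≠ 0) {Q : ℂ[X]} (hQ : Q ≠ 0)
    (h : ErrorCone ω τ Q) :
    ∃ E : Finset ℝ, (∀ x, x ∈ E ↔ x ∈ Set.Icc (-1 : ℝ) 1 ∧
      |(rotVal ω Q x).im| = τ * (rotVal ω Q x).re) ∧ E.card ≤ 2 * Q.natDegree + 2 := by
  classical
  set V : ℂ[X] := derivative Q * conjPoly Q - conjPoly (derivative Q) * Q with hV
  -- On the real line `W` is `2i|Q|²` times the phase derivative of `rotVal ω Q` wherever `Q` is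
  -- nonzero. Since `Q'` has lower degree than `Q`, the term with `ω ≠ 0` dominates and `deg W = 2
  -- deg Q`.
  set W : ℂ[X] := V + C (Complex.I * ω) * (Q * conjPoly Q) with hW
  have hc0 : Complex.I * (ω : ℂ) ≠ 0 := by simp [hω]
  have hdeg : V.degree < (C (Complex.I * ω) * (Q * conjPoly Q)).degree := by
    rw [degree_C_mul hc0, degree_mul, degree_conjPoly]
    have h1 : (derivative Q).degree < Q.degree := degree_derivative_lt hQ
    have hb : Q.degree ≠ ⊥ := by rwa [Ne, degree_eq_bot]
    refine (degree_sub_le _ _).trans_lt (max_lt ?_ ?_)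
    · rw [degree_mul, degree_conjPoly]
      exact WithBot.add_lt_add_right hb h1
    · rw [degree_mul, degree_conjPoly]
      exact WithBot.add_lt_add_right hb h1
  have hWd : W.degree = (C (Complex.I * ω) * (Q * conjPoly Q)).degree :=
    degree_add_eq_right_of_degree_lt hdeg
  have hWn : W.natDegree = 2 * Q.natDegree := by
    rw [natDegree_eq_of_degree_eq hWd, natDegree_C_mul hc0,
      natDegree_mul hQ (conjPoly_ne_zero hQ), natDegree_conjPoly]
    ring
  have hW0 : W ≠ 0 := by
    intro h0
    rw [h0, degree_zero] at hWd
    rw [← hWd] at hdeg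
    exact not_lt_bot hdeg
  set S : Set ℝ := {x | x ∈ Set.Icc (-1 : ℝ) 1 ∧ |(rotVal ω Q x).im| = τ * (rotVal ω Q x).re}
  -- At the endpoints the derivative need not vanish; they account for the `+ 2`.
  set F : Finset ℂ := insert (-1) (insert 1 W.roots.toFinset) with hF
  have hSF : ∀ x ∈ S, (x : ℂ) ∈ F := by
    intro x hx
    by_cases h1 : x = -1
    · simp [hF, h1]
    by_cases h2 : x = 1
    · simp [hF, h2]
    have hx' : x ∈ Set.Ioo (-1 : ℝ) 1 :=
      ⟨lt_of_le_of_ne hx.1.1 (Ne.symm h1), lt_of_le_of_ne hx.1.2 h2⟩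
    have h3 := im_deriv_mul_conj_eq_zero h hx' hx.2
    have h4 : W.eval (x : ℂ) = 0 := by
      rw [hW, eval_add, hV, eval_im_mul_conj]
      simp only [eval_mul, eval_add, eval_C, conjPoly_eval_ofReal] at h3 ⊢
      rw [add_mul, Complex.add_im, mul_assoc, Complex.mul_conj] at h3
      rw [Complex.mul_conj]
      simp at h3
      apply Complex.ext
      · simp
      · simp; linarith
    simp [hF, hW0, h4]
  have hinj : Set.InjOn (fun x : ℝ => (x : ℂ)) S := Complex.ofReal_injective.injOn
  have hfin : S.Finite := by
    refine Set.Finite.of_finite_image (f := fun x : ℝ => (x : ℂ)) ?_ hinj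
    refine F.finite_toSet.subset ?_
    rintro _ ⟨x, hx, rfl⟩
    exact hSF x hx
  refine ⟨hfin.toFinset, fun x => by rw [Set.Finite.mem_toFinset]; rfl, ?_⟩
  calc hfin.toFinset.card ≤ F.card := Finset.card_le_card_of_injOn (fun x : ℝ => (x : ℂ))
        (fun x hx => hSF x (by simpa using hx)) (by simp)
    _ ≤ W.roots.toFinset.card + 1 + 1 :=
        (Finset.card_insert_le _ _).trans (by gcongr; exact Finset.card_insert_le _ _)
    _ ≤ 2 * Q.natDegree + 2 := by
        have := (Multiset.toFinset_card_le W.roots).trans (card_roots' W)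
        omega

/-- At level zero every point of `[-1,1]` would be extremal, contradicting finiteness. -/
lemma eq_zero_of_errorCone_zero {ω : ℝ} (hω : ω ≠ 0) {Q : ℂ[X]} (h : ErrorCone ω 0 Q) : Q = 0 := by
  by_contra hQ
  obtain ⟨E, hE, -⟩ := exists_extremal_finset hω hQ h
  refine Set.Icc_infinite (show (-1 : ℝ) < 1 by norm_num) (E.finite_toSet.subset fun x hx => ?_)
  refine (hE x).2 ⟨hx, ?_⟩
  have := h x hx
  rw [zero_mul] at this ⊢
  exact le_antisymm this (abs_nonneg _)

/-- If the real part stays positive, then some error level is attained on `[-1,1]`. -/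
lemma exists_errorCone_attained {ω : ℝ} {Q : ℂ[X]}
    (h : ∀ x ∈ Set.Icc (-1 : ℝ) 1, 0 < (rotVal ω Q x).re) :
    ∃ x ∈ Set.Icc (-1 : ℝ) 1, ErrorCone ω (|(rotVal ω Q x).im| / (rotVal ω Q x).re) Q := by
  have hc := continuous_rotVal ω Q
  have hcont : ContinuousOn (fun x => |(rotVal ω Q x).im| / (rotVal ω Q x).re)
      (Set.Icc (-1 : ℝ) 1) :=
    (Complex.continuous_im.comp hc).abs.continuousOn.div (Complex.continuous_re.comp hc).continuousOn
      fun x hx => (h x hx).ne'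
  obtain ⟨x, hx, hmax⟩ := isCompact_Icc.exists_isMaxOn
    (Set.nonempty_Icc.2 (show (-1 : ℝ) ≤ 1 by norm_num)) hcont
  exact ⟨x, hx, fun y hy => (div_le_iff₀ (h y hy)).1 (hmax hy)⟩

/-- A minimizing polynomial that is coprime to its conjugate attains the error level at
`n + deg Q + 2` points at least. -/
lemma le_card_extremal {n : ℕ} {ω τ : ℝ} (hτ : 0 < τ) (hmin : IsMinimalLevel n ω τ) {Q : ℂ[X]}
    (hn : Q.natDegree ≤ n) (hc : IsCoprime Q (conjPoly Q)) (h : ErrorCone ω τ Q) {E : Finset ℝ}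
    (hE : ∀ x, x ∈ E ↔ x ∈ Set.Icc (-1 : ℝ) 1 ∧
      |(rotVal ω Q x).im| = τ * (rotVal ω Q x).re) : n + Q.natDegree + 2 ≤ E.card := by
  by_contra! hlt
  have hpos : ∀ x ∈ Set.Icc (-1 : ℝ) 1, 0 < (rotVal ω Q x).re := fun x hx =>
    h.re_pos hτ (eval_ne_zero_of_isCoprime hc x) hx
  -- Too few extremal points leave room to prescribe `Im (H conj Q) = -Im u` at all of them; adding
  -- `εH` then turns `u` towards the positive real axis exactly where the level is attained.
  set S := Lagrange.interpolate E id (fun x => -(rotVal ω Q x).im) with hS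
  have hSE : ∀ x ∈ E, S.eval x = -(rotVal ω Q x).im := fun x hx =>
    Lagrange.eval_interpolate_at_node (v := id) _ (Set.injOn_id _) hx
  have hSd : S.natDegree ≤ n + Q.natDegree := by
    by_cases hS0 : S = 0
    · simp [hS0]
    have h1 : S.degree < E.card := Lagrange.degree_interpolate_lt _ (Set.injOn_id _)
    have h2 := (natDegree_lt_iff_degree_lt hS0).2 h1
    omega
  obtain ⟨H, hHn, hH⟩ := exists_im_mul_conj_eq hc hn S hSd
  have hre : ∀ P, Continuous fun x => (rotVal ω P x).re := fun P =>
    Complex.continuous_re.comp (continuous_rotVal ω P)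
  have him : ∀ P, Continuous fun x => (rotVal ω P x).im := fun P =>
    Complex.continuous_im.comp (continuous_rotVal ω P)
  obtain ⟨ε₁, hε₁, h1⟩ := exists_pos_add_mul (K := Set.Icc (-1 : ℝ) 1) isCompact_Icc
    (f := fun x => τ * (rotVal ω Q x).re - (rotVal ω Q x).im)
    (g := fun x => τ * (rotVal ω H x).re - (rotVal ω H x).im)
    (((hre Q).const_mul τ).sub (him Q)) (((hre H).const_mul τ).sub (him H))
    (fun x hx => by linarith [h x hx, le_abs_self (rotVal ω Q x).im])
    (fun x hx h0 => by
      have hp := hpos x hx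
      have hb : 0 < (rotVal ω Q x).im := by nlinarith
      have hS' := hSE x ((hE x).2 ⟨hx, by rw [abs_of_pos hb]; linarith⟩)
      rw [← hH x, im_mul_conj_eq ω] at hS'
      have e : (τ * (rotVal ω H x).re - (rotVal ω H x).im) * (rotVal ω Q x).re =
        (rotVal ω Q x).im := by linear_combination -hS' + (rotVal ω H x).re * h0
      exact pos_of_mul_pos_left (e ▸ hb) hp.le)
  obtain ⟨ε₂, hε₂, h2⟩ := exists_pos_add_mul (K := Set.Icc (-1 : ℝ) 1) isCompact_Icc
    (f := fun x => τ * (rotVal ω Q x).re + (rotVal ω Q x).im)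
    (g := fun x => τ * (rotVal ω H x).re + (rotVal ω H x).im)
    (((hre Q).const_mul τ).add (him Q)) (((hre H).const_mul τ).add (him H))
    (fun x hx => by linarith [h x hx, neg_abs_le (rotVal ω Q x).im])
    (fun x hx h0 => by
      have hp := hpos x hx
      have hb : (rotVal ω Q x).im < 0 := by nlinarith
      have hS' := hSE x ((hE x).2 ⟨hx, by rw [abs_of_neg hb]; linarith⟩)
      rw [← hH x, im_mul_conj_eq ω] at hS'
      have e : (τ * (rotVal ω H x).re + (rotVal ω H x).im) * (rotVal ω Q x).re =
        -(rotVal ω Q x).im := by linear_combination hS' + (rotVal ω H x).re * h0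
      exact pos_of_mul_pos_left (e ▸ neg_pos.2 hb) hp.le)
  obtain ⟨ε, hε, hε'⟩ := exists_between (lt_min hε₁ hε₂)
  set P := Q + C (ε : ℂ) * H with hP
  have hPv : ∀ x, rotVal ω P x = rotVal ω Q x + ε * rotVal ω H x := fun x => by
    rw [hP, rotVal_add, rotVal_ofReal_mul]
  have hstrict : ∀ x ∈ Set.Icc (-1 : ℝ) 1, 0 < (rotVal ω P x).re ∧
      |(rotVal ω P x).im| < τ * (rotVal ω P x).re := by
    intro x hx
    have e1 := h1 ε hε (hε'.trans_le (min_le_left _ _)) x hx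
    have e2 := h2 ε hε (hε'.trans_le (min_le_right _ _)) x hx
    have e3 : |(rotVal ω P x).im| < τ * (rotVal ω P x).re := by
      rw [hPv]
      simp only [Complex.add_re, Complex.add_im, Complex.re_ofReal_mul, Complex.im_ofReal_mul]
      rw [abs_lt]
      constructor <;> linarith
    exact ⟨pos_of_mul_pos_right ((abs_nonneg _).trans_lt e3) hτ.le, e3⟩
  -- The strict cone inequality on a compact interval gives a level below `τ`, so minimality forces
  -- `P = 0`.
  obtain ⟨y, hy, hcone⟩ := exists_errorCone_attained fun x hx => (hstrict x hx).1
  have hP0 := hmin _ (div_nonneg (abs_nonneg _) (hstrict y hy).1.le)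
    ((div_lt_iff₀ (hstrict y hy).1).2 (hstrict y hy).2) P
    ((natDegree_add_le _ _).trans (max_le hn ((natDegree_C_mul_le _ _).trans hHn))) hcone
  have := (hstrict 0 (by norm_num)).1
  rw [hP0] at this
  simp [rotVal] at this

/-- A minimizing polynomial that is coprime to its conjugate has exact degree `n`. -/
lemma natDegree_eq_of_isMinimalLevel {n : ℕ} {ω τ : ℝ} (hω : ω ≠ 0) (hτ : 0 < τ)
    (hmin : IsMinimalLevel n ω τ) {Q : ℂ[X]}
    (hn : Q.natDegree ≤ n) (hc : IsCoprime Q (conjPoly Q)) (h : ErrorCone ω τ Q) :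
    Q.natDegree = n := by
  have hQ : Q ≠ 0 := by
    rintro rfl
    simpa using eval_ne_zero_of_isCoprime hc 0
  obtain ⟨E, hE, hcard⟩ := exists_extremal_finset hω hQ h
  have := le_card_extremal hτ hmin hn hc h hE
  omega

/-- A sign-free form of the cone condition for polynomials without real zeros. -/
lemma errorCone_or_errorCone_neg {ω τ : ℝ} {P : ℂ[X]} (hP : ∀ x : ℝ, P.eval (x : ℂ) ≠ 0)
    (h2 : ∀ x ∈ Set.Icc (-1 : ℝ) 1, |(rotVal ω P x).im| ≤ τ * |(rotVal ω P x).re|) :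
    ErrorCone ω τ P ∨ ErrorCone ω τ (-P) := by
  have hre : Continuous fun x => (rotVal ω P x).re :=
    Complex.continuous_re.comp (continuous_rotVal ω P)
  -- A zero real part would force a zero of `P`; hence the real part keeps one sign on the interval.
  have h3 : ∀ x ∈ Set.Icc (-1 : ℝ) 1, (rotVal ω P x).re ≠ 0 := by
    intro x hx h0
    have h4 := h2 x hx
    rw [h0, abs_zero, mul_zero] at h4
    exact hP x (rotVal_eq_zero_iff.1 (Complex.ext h0 (abs_nonpos_iff.1 h4)))
  by_cases hs : ∀ x ∈ Set.Icc (-1 : ℝ) 1, 0 ≤ (rotVal ω P x).re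
  · left
    intro x hx
    have := h2 x hx
    rwa [abs_of_nonneg (hs x hx)] at this
  · right
    push Not at hs
    obtain ⟨y, hy, hy0⟩ := hs
    intro x hx
    have hx0 : (rotVal ω P x).re ≤ 0 := by
      by_contra! hx0
      obtain ⟨z, hz, hz0⟩ := isPreconnected_Icc.intermediate_value hy hx hre.continuousOn
        (show (0 : ℝ) ∈ Set.Icc _ _ from ⟨hy0.le, hx0.le⟩)
      exact h3 z hz hz0
    have := h2 x hx
    rw [abs_of_nonpos hx0] at this
    rw [rotVal_neg, Complex.neg_im, Complex.neg_re, abs_neg]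
    exact this

/-- Cancelling a real factor preserves the error cone up to sign. -/
lemma ErrorCone.of_real_mul {ω τ : ℝ} (hτ : 0 ≤ τ) {D : ℝ[X]} (hD : D ≠ 0) {P : ℂ[X]}
    (hP : ∀ x : ℝ, P.eval (x : ℂ) ≠ 0)
    (h : ErrorCone ω τ (D.map (algebraMap ℝ ℂ) * P)) : ErrorCone ω τ P ∨ ErrorCone ω τ (-P) := by
  have hc := continuous_rotVal ω P
  have hre : Continuous fun x => (rotVal ω P x).re := Complex.continuous_re.comp hc
  have him : Continuous fun x => (rotVal ω P x).im := Complex.continuous_im.comp hc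
  have h1 : ∀ x ∈ Set.Icc (-1 : ℝ) 1, D.eval x ≠ 0 →
      |(rotVal ω P x).im| ≤ τ * |(rotVal ω P x).re| := by
    intro x hx hDx
    have h2 := h x hx
    rw [rotVal_real_mul, Complex.re_ofReal_mul, Complex.im_ofReal_mul, abs_mul] at h2
    refine le_of_mul_le_mul_left (h2.trans ?_) (abs_pos.2 hDx)
    calc _ ≤ τ * |D.eval x * (rotVal ω P x).re| := by gcongr; exact le_abs_self _
      _ = _ := by rw [abs_mul]; ring
  refine errorCone_or_errorCone_neg hP ?_
  -- The inequality is known off the finitely many zeros of `D` and extends to them by closedness.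
  have hcl : IsClosed {x | |(rotVal ω P x).im| ≤ τ * |(rotVal ω P x).re|} :=
    isClosed_le him.abs (hre.abs.const_mul τ)
  have hfin : {x | D.eval x = 0}.Finite := by
    refine (D.roots.toFinset.finite_toSet).subset fun x hx => ?_
    simpa [hD] using hx
  have hdense : Dense {x | D.eval x = 0}ᶜ := hfin.countable.dense_compl ℝ
  have hIoo : Set.Ioo (-1 : ℝ) 1 ⊆ closure (Set.Ioo (-1 : ℝ) 1 ∩ {x | D.eval x = 0}ᶜ) :=
    hdense.open_subset_closure_inter isOpen_Ioo
  have hIcc : Set.Icc (-1 : ℝ) 1 ⊆ closure (Set.Ioo (-1 : ℝ) 1 ∩ {x | D.eval x = 0}ᶜ) := by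
    rw [← closure_Ioo (show (-1 : ℝ) ≠ 1 by norm_num)]
    exact closure_minimal hIoo isClosed_closure
  exact fun x hx => closure_minimal
    (fun y hy => h1 y (Set.Ioo_subset_Icc_self hy.1) hy.2) hcl (hIcc hx)

/-- Every minimizing polynomial is coprime to its conjugate and has exact degree `n`. -/
lemma isCoprime_of_isMinimalLevel {n : ℕ} {ω τ : ℝ} (hω : ω ≠ 0) (hτ : 0 < τ)
    (hmin : IsMinimalLevel n ω τ) {Q : ℂ[X]} (hQ : Q ≠ 0)
    (hn : Q.natDegree ≤ n) (h : ErrorCone ω τ Q) :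
    IsCoprime Q (conjPoly Q) ∧ Q.natDegree = n := by
  obtain ⟨D, P, hDP, hc⟩ := exists_real_mul_coprime Q hQ
  have hD : D ≠ 0 := by rintro rfl; simp at hDP; exact hQ hDP
  have hP : P ≠ 0 := by rintro rfl; simp at hDP; exact hQ hDP
  have hD' : D.map (algebraMap ℝ ℂ) ≠ 0 := by rintro h0; rw [h0] at hDP; simp at hDP; exact hQ hDP
  have hdeg : Q.natDegree = D.natDegree + P.natDegree := by
    rw [hDP, natDegree_mul hD' hP, natDegree_map]
  -- The cofactor, up to sign, is itself a minimizer, so it already uses the full degree `n` and `D`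
  -- must be constant.
  have hPn : P.natDegree = n := by
    rcases ErrorCone.of_real_mul hτ.le hD (eval_ne_zero_of_isCoprime hc) (hDP ▸ h) with h1 | h1
    · exact natDegree_eq_of_isMinimalLevel hω hτ hmin (by omega) hc h1
    · rw [← natDegree_neg]
      refine natDegree_eq_of_isMinimalLevel hω hτ hmin (by rw [natDegree_neg]; omega) ?_ h1
      rw [show conjPoly (-P) = -conjPoly P from Polynomial.map_neg _]
      exact hc.neg_neg
  have hD0 : D.natDegree = 0 := by omega
  obtain ⟨d, rfl⟩ := natDegree_eq_zero.1 hD0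
  have hd : d ≠ 0 := by rintro rfl; simp at hD
  refine ⟨?_, by omega⟩
  rw [hDP, conjPoly_mul, conjPoly_map_ofReal]
  have hu : IsUnit ((C d : ℝ[X]).map (algebraMap ℝ ℂ)) := by
    rw [map_C]; exact isUnit_C.2 (by simpa using hd)
  rwa [isCoprime_mul_unit_left hu]

/-! ### Uniqueness of the minimizing polynomial -/

/-- Minimizing polynomials are unique up to a positive factor. -/
lemma eq_C_mul_of_isMinimalLevel {n : ℕ} {ω τ : ℝ} (hω : ω ≠ 0) (hτ : 0 < τ)
    (hmin : IsMinimalLevel n ω τ) {P Q : ℂ[X]} (hP : P ≠ 0) (hQ : Q ≠ 0)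
    (hPn : P.natDegree ≤ n) (hQn : Q.natDegree ≤ n) (hPc : ErrorCone ω τ P)
    (hQc : ErrorCone ω τ Q) : ∃ c : ℝ, Q = C (c : ℂ) * P := by
  obtain ⟨hP1, hP2⟩ := isCoprime_of_isMinimalLevel hω hτ hmin hP hPn hPc
  obtain ⟨hQ1, hQ2⟩ := isCoprime_of_isMinimalLevel hω hτ hmin hQ hQn hQc
  have hRc : ErrorCone ω τ (P + Q) := by
    intro x hx
    rw [rotVal_add, Complex.add_im, Complex.add_re, mul_add]
    exact (abs_add_le _ _).trans (add_le_add (hPc x hx) (hQc x hx))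
  have hR0 : P + Q ≠ 0 := by
    intro h0
    have hx : (0 : ℝ) ∈ Set.Icc (-1 : ℝ) 1 := by norm_num
    have h1 := hPc.re_pos hτ (eval_ne_zero_of_isCoprime hP1 _) hx
    have h2 := hQc.re_pos hτ (eval_ne_zero_of_isCoprime hQ1 _) hx
    have h3 := rotVal_add ω P Q 0
    rw [h0] at h3
    have h4 := congrArg Complex.re h3
    rw [Complex.add_re] at h4
    simp only [rotVal, eval_zero, mul_zero, Complex.zero_re] at h1 h2 h4
    linarith
  have hRn : (P + Q).natDegree ≤ n := (natDegree_add_le _ _).trans (max_le hPn hQn)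
  obtain ⟨hR1, hR2⟩ := isCoprime_of_isMinimalLevel hω hτ hmin hR0 hRn hRc
  obtain ⟨E, hE, -⟩ := exists_extremal_finset hω hR0 hRc
  have hcard := le_card_extremal hτ hmin hRn hR1 hRc hE
  have hzero : P * conjPoly Q - conjPoly P * Q = 0 := by
    refine eq_zero_of_natDegree_lt_card_of_eval_eq_zero' _ (E.map ⟨_, Complex.ofReal_injective⟩)
      ?_ ?_
    · intro z hz
      obtain ⟨x, hx, rfl⟩ := Finset.mem_map.1 hz
      obtain ⟨hxI, hxE⟩ := (hE x).1 hx
      change eval (x : ℂ) _ = 0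
      rw [eval_im_mul_conj, im_mul_conj_eq ω]
      rw [rotVal_add, Complex.add_im, Complex.add_re, mul_add] at hxE
      have h1 := hPc x hxI
      have h2 := hQc x hxI
      have h3 := hPc.re_nonneg hτ hxI
      -- Equality in the sum of two cone inequalities forces equality in each, on the same side of
      -- the cone.
      have key : (rotVal ω P x).im * (rotVal ω Q x).re -
          (rotVal ω P x).re * (rotVal ω Q x).im = 0 := by
        rw [abs_le] at h1 h2
        rcases abs_choice ((rotVal ω P x).im + (rotVal ω Q x).im) with h4 | h4
        · rw [h4] at hxE
          have e1 : (rotVal ω P x).im = τ * (rotVal ω P x).re := by linarith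
          have e2 : (rotVal ω Q x).im = τ * (rotVal ω Q x).re := by linarith
          rw [e1, e2]; ring
        · rw [h4] at hxE
          have e1 : (rotVal ω P x).im = -(τ * (rotVal ω P x).re) := by linarith
          have e2 : (rotVal ω Q x).im = -(τ * (rotVal ω Q x).re) := by linarith
          rw [e1, e2]; ring
      rw [key]; simp
    · rw [Finset.card_map]
      have := natDegree_of_im_mul_conj hPn hQn
      omega
  have hPQ : P ∣ Q := by
    refine hP1.dvd_of_dvd_mul_left ⟨conjPoly Q, ?_⟩
    linear_combination -hzero
  obtain ⟨K, hK⟩ := hPQ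
  have hK0 : K ≠ 0 := by rintro rfl; simp at hK; exact hQ hK
  have hKd : K.natDegree = 0 := by
    have := congrArg natDegree hK
    rw [natDegree_mul hP hK0] at this
    omega
  obtain ⟨c, rfl⟩ := natDegree_eq_zero.1 hKd
  refine ⟨c.re, ?_⟩
  -- Inserting `Q = cP` into `P conj Q = conj P Q` shows that `c` is real.
  have h0 : C (starRingEnd ℂ c) = C c := by
    have h1 : (P * conjPoly P) * C (starRingEnd ℂ c) = (P * conjPoly P) * C c := by
      rw [hK, conjPoly_mul, conjPoly_C] at hzero
      linear_combination hzero
    exact mul_left_cancel₀ (mul_ne_zero hP (conjPoly_ne_zero hP)) h1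
  have h1 : ((c.re : ℝ) : ℂ) = c := Complex.conj_eq_iff_re.1 (C_injective h0)
  rw [h1, hK, mul_comm]

/-! ### A competitor with error below 2 -/

/-- A polynomial of degree at most `n` which on `[-1,1]` keeps the real part of
`exp(iωx/2) Q(x)` positive. -/
lemma exists_rotVal_re_pos (n : ℕ) {ω : ℝ} (h0 : 0 < ω) (h1 : ω < (n + 1) * Real.pi) :
    ∃ Q : ℂ[X], Q.natDegree ≤ n ∧ ∀ x ∈ Set.Icc (-1 : ℝ) 1, 0 < (rotVal ω Q x).re := by
  -- Each factor `jπ - y` changes sign where the sine does, so the product stays nonnegative and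
  -- vanishes only at the `jπ`.
  have hsin : ∀ m : ℕ, ∀ y : ℝ, 0 < y → y < (m + 1) * Real.pi →
      0 ≤ Real.sin y * ∏ j ∈ Finset.Icc 1 m, (j * Real.pi - y) ∧
      (Real.sin y * ∏ j ∈ Finset.Icc 1 m, (j * Real.pi - y) = 0 →
        ∃ j ∈ Finset.Icc 1 m, y = j * Real.pi) := by
    intro m
    induction m with
    | zero =>
      intro y hy hy1
      have := Real.sin_pos_of_pos_of_lt_pi hy (by simpa using hy1)
      simp [this.le, this.ne']
    | succ m ih =>
      intro y hy hy1
      push_cast at hy1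
      rw [Finset.prod_Icc_succ_top (by omega), ← mul_assoc]
      push_cast
      rcases lt_trichotomy y ((m + 1) * Real.pi) with h | h | h
      · obtain ⟨h2, h3⟩ := ih y hy h
        have h4 : 0 < (m + 1) * Real.pi - y := by linarith
        refine ⟨mul_nonneg h2 h4.le, fun h5 => ?_⟩
        obtain ⟨j, hj, hj'⟩ := h3 ((mul_eq_zero.1 h5).resolve_right h4.ne')
        exact ⟨j, Finset.Icc_subset_Icc_right (by omega) hj, hj'⟩
      · refine ⟨by simp [h], fun _ => ⟨m + 1, by simp, by simpa using h⟩⟩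
      · have h2 : 0 < Real.sin (y - (m + 1 : ℕ) * Real.pi) := by
          apply Real.sin_pos_of_pos_of_lt_pi <;> push_cast <;> linarith
        rw [Real.sin_sub_nat_mul_pi] at h2
        have h3 : ∏ j ∈ Finset.Icc 1 (m + 1), ((j : ℝ) * Real.pi - y) =
            (-1) ^ (m + 1) * ∏ j ∈ Finset.Icc 1 (m + 1), (y - (j : ℝ) * Real.pi) := by
          have : (-1 : ℝ) ^ (m + 1) = ∏ j ∈ Finset.Icc 1 (m + 1), (-1 : ℝ) := by simp
          rw [this, ← Finset.prod_mul_distrib]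
          exact Finset.prod_congr rfl fun j _ => by ring
        have h4 : 0 < ∏ j ∈ Finset.Icc 1 (m + 1), (y - (j : ℝ) * Real.pi) := by
          refine Finset.prod_pos fun j hj => ?_
          have h5 : (j : ℝ) ≤ m + 1 := by exact_mod_cast (Finset.mem_Icc.1 hj).2
          nlinarith [Real.pi_pos]
        have h6 : 0 < Real.sin y * (∏ j ∈ Finset.Icc 1 m, ((j : ℝ) * Real.pi - y)) *
            ((m + 1) * Real.pi - y) := by
          have h7 := Finset.prod_Icc_succ_top (show 1 ≤ m + 1 by omega)
            (fun j : ℕ => (j : ℝ) * Real.pi - y)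
          push_cast at h7
          rw [mul_assoc, ← h7, h3, ← mul_assoc, mul_comm (Real.sin y)]
          exact mul_pos h2 h4
        exact ⟨h6.le, fun h => absurd h h6.ne'⟩
  set P : ℝ[X] := ∏ j ∈ Finset.Icc 1 n, (C ((j : ℕ) * Real.pi) - X) with hP
  have hinj : Set.InjOn (fun j : ℕ => (j : ℝ) * Real.pi) (Finset.Icc 1 n : Finset ℕ) := by
    intro a _ b _ hab
    exact_mod_cast mul_right_cancel₀ Real.pi_ne_zero hab
  -- At the zeros `jπ` this makes `cos · R = cos² = 1`, so a small multiple of it repairs positivity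
  -- there.
  set R : ℝ[X] := Lagrange.interpolate (Finset.Icc 1 n) (fun j : ℕ => (j : ℝ) * Real.pi)
    (fun j => Real.cos (j * Real.pi)) with hR
  have hPe : ∀ y, P.eval y = ∏ j ∈ Finset.Icc 1 n, ((j : ℝ) * Real.pi - y) := fun y => by
    rw [hP, eval_prod]; simp
  have hPd : P.natDegree ≤ n := by
    refine (natDegree_prod_le _ _).trans ?_
    calc _ ≤ ∑ j ∈ Finset.Icc 1 n, 1 := Finset.sum_le_sum fun j _ => by
          exact (natDegree_sub_le _ _).trans (by rw [natDegree_C, natDegree_X]; omega)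
      _ = n := by simp
  have hRd : R.natDegree ≤ n := by
    by_cases hR0 : R = 0
    · simp [hR0]
    have := (natDegree_lt_iff_degree_lt hR0).2 (Lagrange.degree_interpolate_lt _ hinj)
    simp at this
    omega
  have hRe : ∀ j ∈ Finset.Icc 1 n, R.eval ((j : ℝ) * Real.pi) = Real.cos (j * Real.pi) :=
    fun j hj => Lagrange.eval_interpolate_at_node _ hinj hj
  -- Maps `[-1,1]` onto the interval of length `ω` centred in `(0, (n+1)π)`; it fits inside because
  -- `ω < (n+1)π`.
  set ℓ : ℝ → ℝ := fun x => ω / 2 * x + (n + 1) * Real.pi / 2 with hℓ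
  have hℓc : Continuous ℓ := by fun_prop
  obtain ⟨ε₀, hε₀, hε⟩ := exists_pos_add_mul (K := Set.Icc (-1 : ℝ) 1) isCompact_Icc
    (f := fun x => Real.sin (ℓ x) * P.eval (ℓ x)) (g := fun x => Real.cos (ℓ x) * R.eval (ℓ x))
    ((Real.continuous_sin.comp hℓc).mul (P.continuous.comp hℓc))
    ((Real.continuous_cos.comp hℓc).mul (R.continuous.comp hℓc))
    (fun x hx => by
      rw [hPe]
      exact (hsin n (ℓ x) (by simp only [hℓ]; nlinarith [hx.1]) (by simp only [hℓ]; nlinarith [hx.2])).1)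
    (fun x hx h => by
      rw [hPe] at h
      obtain ⟨j, hj, hj'⟩ := (hsin n (ℓ x) (by simp only [hℓ]; nlinarith [hx.1])
        (by simp only [hℓ]; nlinarith [hx.2])).2 h
      rw [hj', hRe j hj, ← sq]
      have h2 := Real.sin_sq_add_cos_sq (j * Real.pi)
      rw [Real.sin_nat_mul_pi] at h2
      nlinarith)
  obtain ⟨ε, hε1, hε2⟩ := exists_between hε₀
  set L : ℝ[X] := C (ω / 2) * X + C ((n + 1) * Real.pi / 2) with hL
  have hLd : L.natDegree ≤ 1 := natDegree_linear_le
  -- Chosen so that `exp(iωx/2) c = sin ℓ(x) - i cos ℓ(x)`; the real part of its product with `P +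
  -- iεR` is `sin · P + ε cos · R`.
  set c : ℂ := Complex.exp ((((n + 1) * Real.pi / 2 : ℝ) : ℂ) * Complex.I) * (-Complex.I) with hc
  have hcomp : ∀ p : ℝ[X], p.natDegree ≤ n →
      ((p.comp L).map (algebraMap ℝ ℂ)).natDegree ≤ n := fun p hp => by
    rw [natDegree_map]
    refine natDegree_comp_le.trans ?_
    nlinarith
  refine ⟨C c * ((P.comp L).map (algebraMap ℝ ℂ) +
    C (ε * Complex.I) * (R.comp L).map (algebraMap ℝ ℂ)), ?_, fun x hx => ?_⟩
  · refine (natDegree_C_mul_le _ _).trans ((natDegree_add_le _ _).trans (max_le (hcomp P hPd)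
      ((natDegree_C_mul_le _ _).trans (hcomp R hRd))))
  · have h2 := hε ε hε1 hε2 x hx
    have h3 : L.eval x = ℓ x := by simp [hL, hℓ]
    have h4 : Complex.exp (((ω * x / 2 : ℝ) : ℂ) * Complex.I) *
        Complex.exp ((((n + 1) * Real.pi / 2 : ℝ) : ℂ) * Complex.I) =
        (Real.cos (ℓ x) : ℂ) + (Real.sin (ℓ x) : ℂ) * Complex.I := by
      rw [← Complex.exp_add, ← add_mul, ← Complex.ofReal_add,
        show ω * x / 2 + (n + 1) * Real.pi / 2 = ℓ x by simp only [hℓ]; ring,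
        Complex.exp_mul_I, Complex.ofReal_cos, Complex.ofReal_sin]
    rw [rotVal]
    simp only [eval_mul, eval_add, eval_C, eval_map_ofReal, eval_comp, h3, hc]
    rw [← mul_assoc, ← mul_assoc, h4]
    simp only [Complex.mul_re, Complex.add_re, Complex.add_im, Complex.mul_im, Complex.neg_re,
      Complex.neg_im, Complex.ofReal_re, Complex.ofReal_im, Complex.I_re, Complex.I_im]
    linarith

/-! ### Compactness in the coefficients -/

/-- The polynomial with given coefficients. -/
noncomputable def vecPoly {n : ℕ} (v : Fin (n + 1) → ℂ) : ℂ[X] := ∑ i, C (v i) * X ^ (i : ℕ)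

lemma coeff_vecPoly {n : ℕ} (v : Fin (n + 1) → ℂ) (i : Fin (n + 1)) :
    (vecPoly v).coeff i = v i := by
  simp [vecPoly, coeff_C_mul, coeff_X_pow, Fin.val_inj]

lemma natDegree_vecPoly {n : ℕ} (v : Fin (n + 1) → ℂ) : (vecPoly v).natDegree ≤ n :=
  natDegree_sum_le_of_forall_le _ _ fun i _ =>
    (natDegree_C_mul_X_pow_le _ _).trans (by omega)

lemma vecPoly_ne_zero {n : ℕ} {v : Fin (n + 1) → ℂ} (hv : v ≠ 0) : vecPoly v ≠ 0 := by
  intro h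
  apply hv
  funext i
  rw [← coeff_vecPoly v i, h]
  simp

lemma vecPoly_coeff {n : ℕ} {Q : ℂ[X]} (hn : Q.natDegree ≤ n) :
    vecPoly (fun i : Fin (n + 1) => Q.coeff i) = Q := by
  conv_rhs => rw [Q.as_sum_range_C_mul_X_pow' (show Q.natDegree < n + 1 by omega)]
  rw [vecPoly, Fin.sum_univ_eq_sum_range (fun i => C (Q.coeff i) * X ^ i)]

lemma continuous_eval_vecPoly (n : ℕ) :
    Continuous fun p : (Fin (n + 1) → ℂ) × ℝ => (vecPoly p.1).eval (p.2 : ℂ) := by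
  simp only [vecPoly, eval_finsetSum, eval_mul, eval_C, eval_pow, eval_X]
  fun_prop

/-- Positive scaling preserves the cone, so the search can be confined to the compact unit sphere of
coefficients. -/
lemma exists_unit_vecPoly {n : ℕ} {Q : ℂ[X]} (hn : Q.natDegree ≤ n) (hQ : Q ≠ 0) :
    ∃ c : ℝ, 0 < c ∧ ∃ v : Fin (n + 1) → ℂ, ‖v‖ = 1 ∧ vecPoly v = C (c : ℂ) * Q := by
  set w : Fin (n + 1) → ℂ := fun i => Q.coeff i with hw
  have hwQ : vecPoly w = Q := vecPoly_coeff hn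
  have hw0 : w ≠ 0 := by
    intro h
    rw [h] at hwQ
    exact hQ (by rw [← hwQ]; simp [vecPoly])
  refine ⟨‖w‖⁻¹, by positivity, (‖w‖⁻¹ : ℝ) • w, ?_, ?_⟩
  · rw [norm_smul]; simp [hw0]
  · rw [← hwQ]
    simp [vecPoly, Finset.mul_sum, mul_assoc]

lemma ErrorCone.C_mul {ω τ c : ℝ} {Q : ℂ[X]} (h : ErrorCone ω τ Q) (hc : 0 ≤ c) :
    ErrorCone ω τ (C (c : ℂ) * Q) := by
  intro x hx
  rw [rotVal_ofReal_mul, Complex.re_ofReal_mul, Complex.im_ofReal_mul, abs_mul, abs_of_nonneg hc]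
  nlinarith [mul_le_mul_of_nonneg_left (h x hx) hc]

lemma isClosed_setOf_errorCone (n : ℕ) (ω : ℝ) :
    IsClosed {p : (Fin (n + 1) → ℂ) × ℝ | ErrorCone ω p.2 (vecPoly p.1)} := by
  have hr : ∀ x : ℝ, Continuous fun p : (Fin (n + 1) → ℂ) × ℝ => rotVal ω (vecPoly p.1) x := by
    intro x
    have := (continuous_eval_vecPoly n).comp (f := fun p : (Fin (n + 1) → ℂ) × ℝ => (p.1, x))
      (by fun_prop)
    exact continuous_const.mul this
  simp only [ErrorCone, Set.ofPred_forall]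
  refine isClosed_iInter fun x => isClosed_iInter fun _ => ?_
  exact isClosed_le (Complex.continuous_im.comp (hr x)).abs
    (continuous_snd.mul (Complex.continuous_re.comp (hr x)))

/-- The minimal error level is attained. -/
lemma exists_isMinimalLevel {n : ℕ} {ω τ₁ : ℝ} (hτ₁ : 0 ≤ τ₁) {Q₁ : ℂ[X]} (hQ₁ : Q₁ ≠ 0)
    (hn : Q₁.natDegree ≤ n) (h : ErrorCone ω τ₁ Q₁) :
    ∃ τ, 0 ≤ τ ∧ IsMinimalLevel n ω τ ∧
      ∃ Q : ℂ[X], Q ≠ 0 ∧ Q.natDegree ≤ n ∧ ErrorCone ω τ Q := by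
  set Z : Set ((Fin (n + 1) → ℂ) × ℝ) := (Metric.sphere 0 1 ×ˢ Set.Icc 0 τ₁) ∩
    {p | ErrorCone ω p.2 (vecPoly p.1)} with hZ
  have hZc : IsCompact Z :=
    ((isCompact_sphere 0 1).prod isCompact_Icc).inter_right (isClosed_setOf_errorCone n ω)
  have hmem : ∀ t, 0 ≤ t → t ≤ τ₁ → ∀ Q : ℂ[X], Q.natDegree ≤ n → Q ≠ 0 → ErrorCone ω t Q →
      ∃ v, (v, t) ∈ Z := by
    intro t ht ht1 Q hQn hQ hQt
    obtain ⟨c, hc, v, hv, hvQ⟩ := exists_unit_vecPoly hQn hQ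
    refine ⟨v, ⟨by simpa using hv, ht, ht1⟩, ?_⟩
    change ErrorCone ω t (vecPoly v)
    rw [hvQ]
    exact hQt.C_mul hc.le
  obtain ⟨v₁, hv₁⟩ := hmem τ₁ hτ₁ le_rfl Q₁ hn hQ₁ h
  obtain ⟨⟨v, τ⟩, hv, hmin⟩ := hZc.exists_isMinOn ⟨_, hv₁⟩ continuous_snd.continuousOn
  refine ⟨τ, hv.1.2.1, ?_, vecPoly v, vecPoly_ne_zero ?_, natDegree_vecPoly v, hv.2⟩
  · intro t ht htτ Q hQn hQt
    by_contra hQ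
    obtain ⟨w, hw⟩ := hmem t ht (htτ.le.trans hv.1.2.2) Q hQn hQ hQt
    exact absurd (hmin hw) (not_le.2 htτ)
  · rintro rfl
    simpa using hv.1.1

/-- Near-minimizing polynomials have phases uniformly close to that of the minimizer. -/
lemma exists_delta_of_isMinimalLevel {n : ℕ} {ω τ : ℝ} (hω : ω ≠ 0) (hτ : 0 < τ)
    (hmin : IsMinimalLevel n ω τ) {Q : ℂ[X]} (hQ : Q ≠ 0) (hn : Q.natDegree ≤ n)
    (h : ErrorCone ω τ Q) {η : ℝ} (hη : 0 < η) :
    ∃ δ > 0, ∀ t, 0 ≤ t → t < τ + δ → ∀ P : ℂ[X], P ≠ 0 → P.natDegree ≤ n → ErrorCone ω t P →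
      ∀ x ∈ Set.Icc (-1 : ℝ) 1,
        ‖starRingEnd ℂ (P.eval (x : ℂ)) * Q.eval (x : ℂ) -
          starRingEnd ℂ (Q.eval (x : ℂ)) * P.eval (x : ℂ)‖ <
        η * (‖P.eval (x : ℂ)‖ * ‖Q.eval (x : ℂ)‖) := by
  have hQ0 : ∀ x : ℝ, Q.eval (x : ℂ) ≠ 0 :=
    eval_ne_zero_of_isCoprime (isCoprime_of_isMinimalLevel hω hτ hmin hQ hn h).1
  set Z : Set (((Fin (n + 1) → ℂ) × ℝ) × ℝ) :=
    ((Metric.sphere 0 1 ×ˢ Set.Icc 0 (τ + 1)) ×ˢ Set.Icc (-1) 1) ∩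
    ({p | ErrorCone ω p.1.2 (vecPoly p.1.1)} ∩
      {p | η * (‖(vecPoly p.1.1).eval (p.2 : ℂ)‖ * ‖Q.eval (p.2 : ℂ)‖) ≤
        ‖starRingEnd ℂ ((vecPoly p.1.1).eval (p.2 : ℂ)) * Q.eval (p.2 : ℂ) -
          starRingEnd ℂ (Q.eval (p.2 : ℂ)) * (vecPoly p.1.1).eval (p.2 : ℂ)‖}) with hZ
  have hZc : IsCompact Z := by
    refine (((isCompact_sphere 0 1).prod isCompact_Icc).prod isCompact_Icc).inter_right
      (((isClosed_setOf_errorCone n ω).preimage continuous_fst).inter ?_)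
    have h1 : Continuous fun p : ((Fin (n + 1) → ℂ) × ℝ) × ℝ =>
        (vecPoly p.1.1).eval (p.2 : ℂ) :=
      (continuous_eval_vecPoly n).comp (f := fun p : ((Fin (n + 1) → ℂ) × ℝ) × ℝ => (p.1.1, p.2))
        (by fun_prop)
    have h2 : Continuous fun p : ((Fin (n + 1) → ℂ) × ℝ) × ℝ => Q.eval (p.2 : ℂ) :=
      Q.continuous.comp (by fun_prop)
    exact isClosed_le ((h1.norm.mul h2.norm).const_mul η)
      (((Complex.continuous_conj.comp h1).mul h2).sub
        ((Complex.continuous_conj.comp h2).mul h1)).norm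
  -- At level `τ` only real multiples of `Q` remain, and for these the phase difference is zero, so
  -- they are not in `Z`.
  have hgt : ∀ p ∈ Z, τ < p.1.2 := by
    rintro ⟨⟨v, t⟩, x⟩ ⟨⟨⟨hv, ht⟩, hx⟩, hcone, hfar⟩
    simp only [Set.mem_ofPred_eq] at hcone hfar
    by_contra! hle
    simp only at hle
    have hv0 : v ≠ 0 := by rintro rfl; simp at hv
    rcases hle.lt_or_eq with hlt | rfl
    · exact vecPoly_ne_zero hv0 (hmin t ht.1 hlt _ (natDegree_vecPoly v) hcone)
    · have hc := (isCoprime_of_isMinimalLevel hω hτ hmin (vecPoly_ne_zero hv0)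
        (natDegree_vecPoly v) hcone).1
      have hx0 := eval_ne_zero_of_isCoprime hc x
      obtain ⟨c, hcQ⟩ := eq_C_mul_of_isMinimalLevel hω hτ hmin hQ (vecPoly_ne_zero hv0) hn
        (natDegree_vecPoly v) h hcone
      have hz : starRingEnd ℂ ((vecPoly v).eval (x : ℂ)) * Q.eval (x : ℂ) -
          starRingEnd ℂ (Q.eval (x : ℂ)) * (vecPoly v).eval (x : ℂ) = 0 := by
        rw [hcQ, eval_mul, eval_C, map_mul, Complex.conj_ofReal]; ring
      rw [hz, norm_zero] at hfar
      have := mul_pos hη (mul_pos (norm_pos_iff.2 hx0) (norm_pos_iff.2 (hQ0 x)))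
      linarith
  -- `δ ≤ 1` keeps the levels within the bound `τ + 1` built into `Z`.
  obtain ⟨δ, hδ, hδ1, hδZ⟩ : ∃ δ > 0, δ ≤ 1 ∧ ∀ p ∈ Z, τ + δ ≤ p.1.2 := by
    rcases Z.eq_empty_or_nonempty with he | hne
    · exact ⟨1, one_pos, le_rfl, by simp [he]⟩
    · obtain ⟨p, hp, hpm⟩ := hZc.exists_isMinOn hne
        (continuous_snd.comp continuous_fst).continuousOn
      refine ⟨min 1 (p.1.2 - τ), lt_min one_pos (sub_pos.2 (hgt p hp)), min_le_left _ _,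
        fun q hq => ?_⟩
      have h1 : p.1.2 ≤ q.1.2 := hpm hq
      linarith [min_le_right 1 (p.1.2 - τ)]
  refine ⟨δ, hδ, fun t ht htδ P hP hPn hPc x hx => ?_⟩
  by_contra! hfar
  obtain ⟨c, hc, v, hv, hvP⟩ := exists_unit_vecPoly hPn hP
  have hmem : ((v, t), x) ∈ Z := by
    refine ⟨⟨⟨by simpa using hv, ht, by linarith⟩, hx⟩, ?_, ?_⟩
    · change ErrorCone ω t (vecPoly v)
      rw [hvP]
      exact hPc.C_mul hc.le
    · change η * (‖(vecPoly v).eval (x : ℂ)‖ * _) ≤ ‖_ - _ * (vecPoly v).eval (x : ℂ)‖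
      rw [hvP, eval_mul, eval_C, map_mul, Complex.conj_ofReal,
        show (c : ℂ) * starRingEnd ℂ (P.eval (x : ℂ)) * Q.eval (x : ℂ) -
          starRingEnd ℂ (Q.eval (x : ℂ)) * (c * P.eval (x : ℂ)) =
          c * (starRingEnd ℂ (P.eval (x : ℂ)) * Q.eval (x : ℂ) -
          starRingEnd ℂ (Q.eval (x : ℂ)) * P.eval (x : ℂ)) by ring,
        norm_mul, norm_mul, Complex.norm_of_nonneg hc.le]
      nlinarith [mul_le_mul_of_nonneg_left hfar hc.le]
  exact absurd (hδZ _ hmem) (not_le.2 htδ)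

/-! ### Unitary functions as conjugate quotients -/

lemma natDegree_comp_C_mul_X_le {n : ℕ} {p : ℂ[X]} (hp : p.natDegree ≤ n) (c : ℂ) :
    (p.comp (C c * X)).natDegree ≤ n := by
  refine natDegree_comp_le.trans ?_
  have : (C c * X : ℂ[X]).natDegree ≤ 1 :=
    (natDegree_C_mul_le _ _).trans natDegree_X_le
  nlinarith

lemma ratVal_eq (r : RatFunc ℂ) (z : ℂ) : ratVal r z = r.num.eval z / r.denom.eval z := by
  simp [ratVal, RatFunc.eval]

/-- Unitary rational functions are of the form `conj Q / Q` on the imaginary axis. -/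
lemma exists_conj_div_of_mem {n : ℕ} {r : RatFunc ℂ} (hr : r ∈ unitaryClass n) :
    ∃ Q : ℂ[X], Q.natDegree ≤ n ∧ (∀ x : ℝ, Q.eval (x : ℂ) ≠ 0) ∧
      ∀ x : ℝ, ratVal r (Complex.I * x) = starRingEnd ℂ (Q.eval (x : ℂ)) / Q.eval (x : ℂ) := by
  obtain ⟨⟨p, q, -, hqn, hq0, hpq⟩, hu⟩ := hr
  have hdn : r.denom.natDegree ≤ n :=
    (natDegree_le_of_dvd (hpq ▸ RatFunc.denom_div_dvd p q) hq0).trans hqn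
  set N := r.num.comp (C Complex.I * X) with hN
  set M := r.denom.comp (C Complex.I * X) with hM
  have hMn : M.natDegree ≤ n := natDegree_comp_C_mul_X_le hdn _
  have hval : ∀ x : ℝ, ratVal r (Complex.I * x) = N.eval (x : ℂ) / M.eval (x : ℂ) := fun x => by
    simp [ratVal_eq, hN, hM]
  have hM0 : ∀ x : ℝ, M.eval (x : ℂ) ≠ 0 := by
    intro x h0
    have := hu x
    rw [hval, h0, div_zero, norm_zero] at this
    exact zero_ne_one this
  have hnorm : ∀ x : ℝ, ‖N.eval (x : ℂ)‖ = ‖M.eval (x : ℂ)‖ := by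
    intro x
    have := hu x
    rwa [hval, norm_div, div_eq_one_iff_eq (norm_ne_zero_iff.2 (hM0 x))] at this
  -- Equal moduli on the real line become a polynomial identity; with coprimality, `conj N` and `M`
  -- divide each other.
  have hNM : N * conjPoly N = M * conjPoly M := by
    apply eq_of_forall_real_eval
    intro x
    simp only [eval_mul, conjPoly_eval_ofReal, Complex.mul_conj, Complex.normSq_eq_norm_sq, hnorm x]
  have hcop : IsCoprime N M :=
    (RatFunc.isCoprime_num_denom r).map (compRingHom (C Complex.I * X))
  have hcop' : IsCoprime (conjPoly N) (conjPoly M) := hcop.map (mapRingHom (starRingEnd ℂ))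
  have h1 : M ∣ conjPoly N := hcop.symm.dvd_of_dvd_mul_left ⟨conjPoly M, hNM⟩
  have h2 : conjPoly N ∣ M := hcop'.dvd_of_dvd_mul_right ⟨N, by rw [← hNM, mul_comm]⟩
  obtain ⟨u, hu'⟩ := associated_of_dvd_dvd h1 h2
  obtain ⟨c, -, hc⟩ := Polynomial.isUnit_iff.1 u.isUnit
  rw [← hc] at hu'
  have hNx : ∀ x : ℝ, N.eval (x : ℂ) = starRingEnd ℂ c * starRingEnd ℂ (M.eval (x : ℂ)) := by
    intro x
    have := congrArg (fun p => starRingEnd ℂ (p.eval (x : ℂ))) hu'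
    simp only [conjPoly_eval_ofReal, Complex.conj_conj, eval_mul, eval_C, map_mul] at this
    rw [← this, mul_comm]
  have hcn : ‖c‖ = 1 := by
    have h3 := hnorm 0
    rw [hNx, norm_mul, RCLike.norm_conj, RCLike.norm_conj] at h3
    exact mul_right_cancel₀ (norm_ne_zero_iff.2 (hM0 0)) (by rw [h3, one_mul])
  -- A square root of the unimodular constant can be absorbed into `Q`, because `conj μ / μ = conj
  -- (μ²)`.
  obtain ⟨μ, hμ⟩ := IsAlgClosed.exists_pow_nat_eq c (show 0 < 2 by norm_num)
  have hμn : ‖μ‖ = 1 := by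
    have h3 := congrArg norm hμ
    rw [norm_pow, hcn] at h3
    exact (pow_eq_one_iff_of_nonneg (norm_nonneg _) two_ne_zero).1 h3
  have hμ0 : μ ≠ 0 := by rintro rfl; simp at hμn
  have hμc : μ * starRingEnd ℂ μ = 1 := by
    rw [Complex.mul_conj, Complex.normSq_eq_norm_sq, hμn]; simp
  refine ⟨C μ * M, (natDegree_C_mul_le _ _).trans hMn, fun x => ?_, fun x => ?_⟩
  · rw [eval_mul, eval_C]
    exact mul_ne_zero hμ0 (hM0 x)
  · rw [hval, hNx, eval_mul, eval_C, map_mul, ← hμ, map_pow,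
      div_eq_div_iff (hM0 x) (mul_ne_zero hμ0 (hM0 x))]
    linear_combination (starRingEnd ℂ μ * starRingEnd ℂ (M.eval (x : ℂ)) * M.eval (x : ℂ)) * hμc

/-- Polynomials without real zeros give unitary rational functions. -/
lemma exists_mem_of_conj_div {n : ℕ} {Q : ℂ[X]} (hn : Q.natDegree ≤ n)
    (h0 : ∀ x : ℝ, Q.eval (x : ℂ) ≠ 0) :
    ∃ r ∈ unitaryClass n, ∀ x : ℝ,
      ratVal r (Complex.I * x) = starRingEnd ℂ (Q.eval (x : ℂ)) / Q.eval (x : ℂ) := by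
  set p := (conjPoly Q).comp (C (-Complex.I) * X) with hp
  set q := Q.comp (C (-Complex.I) * X) with hq
  have hI : ∀ x : ℝ, -Complex.I * (Complex.I * x) = x := fun x => by
    linear_combination (-(x : ℂ)) * Complex.I_mul_I
  have hpx : ∀ x : ℝ, p.eval (Complex.I * x) = starRingEnd ℂ (Q.eval (x : ℂ)) := fun x => by
    rw [hp, eval_comp, eval_mul, eval_C, eval_X, hI, conjPoly_eval_ofReal]
  have hqx : ∀ x : ℝ, q.eval (Complex.I * x) = Q.eval (x : ℂ) := fun x => by
    rw [hq, eval_comp, eval_mul, eval_C, eval_X, hI]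
  have hq0 : q ≠ 0 := by
    intro h
    apply h0 0
    rw [← hqx, h, eval_zero]
  set r : RatFunc ℂ := algebraMap ℂ[X] (RatFunc ℂ) p / algebraMap ℂ[X] (RatFunc ℂ) q with hr
  have hval : ∀ x : ℝ,
      ratVal r (Complex.I * x) = starRingEnd ℂ (Q.eval (x : ℂ)) / Q.eval (x : ℂ) := by
    intro x
    -- `p / q` need not be in lowest terms, so the value is obtained by cross-multiplying with the
    -- reduced fraction.
    have h1 := congrArg (eval (Complex.I * (x : ℂ))) ((RatFunc.num_mul_eq_mul_denom_iff hq0).2 hr)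
    rw [eval_mul, eval_mul, hpx, hqx] at h1
    have h2 : r.denom.eval (Complex.I * (x : ℂ)) ≠ 0 := by
      intro h3
      apply h0 x
      rw [← hqx]
      exact eval_eq_zero_of_dvd_of_eval_eq_zero (RatFunc.denom_div_dvd p q) h3
    rw [ratVal_eq, div_eq_div_iff h2 (h0 x), h1]
  refine ⟨r, ⟨⟨p, q, natDegree_comp_C_mul_X_le (by rwa [natDegree_conjPoly]) _,
    natDegree_comp_C_mul_X_le hn _, hq0, hr⟩, fun x => ?_⟩, hval⟩
  rw [hval, norm_div, RCLike.norm_conj, div_self (norm_ne_zero_iff.2 (h0 x))]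

/-- Unitary rational functions are determined by their values on the imaginary axis. -/
lemma eq_of_ratVal_eq {r s : RatFunc ℂ} (hr : IsUnitaryRational r) (hs : IsUnitaryRational s)
    (h : ∀ x : ℝ, ratVal r (Complex.I * x) = ratVal s (Complex.I * x)) : r = s := by
  have hd : ∀ {r : RatFunc ℂ}, IsUnitaryRational r → ∀ x : ℝ,
      r.denom.eval (Complex.I * (x : ℂ)) ≠ 0 := by
    intro r hr x h0
    have := hr x
    rw [ratVal_eq, h0, div_zero, norm_zero] at this
    exact zero_ne_one this
  have h1 : r.num * s.denom = s.num * r.denom := by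
    apply Polynomial.eq_of_infinite_eval_eq
    refine Set.Infinite.mono (s := Set.range (fun x : ℝ => Complex.I * (x : ℂ))) ?_
      (Set.infinite_range_of_injective
        ((mul_right_injective₀ Complex.I_ne_zero).comp Complex.ofReal_injective))
    rintro _ ⟨x, rfl⟩
    have h2 := h x
    rw [ratVal_eq, ratVal_eq, div_eq_div_iff (hd hr x) (hd hs x)] at h2
    simpa using h2
  rw [(RatFunc.num_mul_eq_mul_denom_iff s.denom_ne_zero).1 h1, RatFunc.num_div_denom]

/-! ### From approximation error to cone level -/

/-- With `u = rotVal ω Q x`, the difference equals `exp(iωx/2) (conj u - u) / Q(x)`. -/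
lemma norm_conj_div_sub_exp (ω : ℝ) {Q : ℂ[X]} {x : ℝ} (h0 : Q.eval (x : ℂ) ≠ 0) :
    ‖starRingEnd ℂ (Q.eval (x : ℂ)) / Q.eval (x : ℂ) - Complex.exp (ω * (Complex.I * x))‖ =
      2 * |(rotVal ω Q x).im| / ‖Q.eval (x : ℂ)‖ := by
  set e := Complex.exp (((ω * x / 2 : ℝ) : ℂ) * Complex.I) with he
  have he1 : e * starRingEnd ℂ e = 1 := by
    rw [he, Complex.mul_conj, Complex.normSq_eq_norm_sq, Complex.norm_exp_ofReal_mul_I]; simp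
  have he2 : Complex.exp (ω * (Complex.I * x)) = e * e := by
    rw [he, ← Complex.exp_add]; congr 1; push_cast; ring
  have h1 : starRingEnd ℂ (Q.eval (x : ℂ)) / Q.eval (x : ℂ) - Complex.exp (ω * (Complex.I * x)) =
      e * (starRingEnd ℂ (rotVal ω Q x) - rotVal ω Q x) / Q.eval (x : ℂ) := by
    rw [he2, rotVal, ← he, map_mul]
    field_simp
    linear_combination (-starRingEnd ℂ (Q.eval (x : ℂ))) * he1
  have h2 : starRingEnd ℂ (rotVal ω Q x) - rotVal ω Q x =
      ((-(2 * (rotVal ω Q x).im) : ℝ) : ℂ) * Complex.I := by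
    apply Complex.ext
    · simp
    · simp; ring
  rw [h1, h2, norm_div, norm_mul, he, Complex.norm_exp_ofReal_mul_I, norm_mul, Complex.norm_real,
    Complex.norm_I, Real.norm_eq_abs, abs_neg, abs_mul, abs_two, one_mul, mul_one]

lemma imagNorm_le {f : ℂ → ℂ} {E : ℝ}
    (h : ∀ x ∈ Set.Icc (-1 : ℝ) 1, ‖f (Complex.I * x)‖ ≤ E) : imagNorm f ≤ E := by
  refine csSup_le (Set.Nonempty.image _ (Set.nonempty_Icc.2 (by norm_num))) ?_
  rintro _ ⟨x, hx, rfl⟩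
  exact h x hx

lemma imagNorm_nonneg (f : ℂ → ℂ) : 0 ≤ imagNorm f := by
  apply Real.sSup_nonneg
  rintro _ ⟨x, -, rfl⟩
  exact norm_nonneg _

lemma norm_sub_exp_le_expError {r : RatFunc ℂ} (hr : IsUnitaryRational r) (ω : ℝ) {x : ℝ}
    (hx : x ∈ Set.Icc (-1 : ℝ) 1) :
    ‖ratVal r (Complex.I * x) - Complex.exp (ω * (Complex.I * x))‖ ≤ expError ω r := by
  -- The supremum needs an upper bound; two unimodular values differ by at most 2.
  refine le_csSup ⟨2, ?_⟩ ⟨x, hx, rfl⟩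
  rintro _ ⟨y, -, rfl⟩
  refine (norm_sub_le _ _).trans ?_
  rw [hr y, show (ω : ℂ) * (Complex.I * y) = ((ω * y : ℝ) : ℂ) * Complex.I by push_cast; ring,
    Complex.norm_exp_ofReal_mul_I]
  norm_num

/-- The tangent of half the phase error that corresponds to an approximation error `E < 2`. -/
noncomputable def errorLevel (E : ℝ) : ℝ := E / √(4 - E ^ 2)

lemma four_sub_sq_pos {E : ℝ} (h0 : 0 ≤ E) (h2 : E < 2) : 0 < 4 - E ^ 2 := by nlinarith

lemma errorLevel_nonneg {E : ℝ} (h0 : 0 ≤ E) : 0 ≤ errorLevel E :=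
  div_nonneg h0 (Real.sqrt_nonneg _)

lemma errorLevel_lt {E E' : ℝ} (h0 : 0 ≤ E) (h : E < E') (h2 : E' < 2) :
    errorLevel E < errorLevel E' := by
  have h1 := four_sub_sq_pos (h0.trans h.le) h2
  exact div_lt_div₀ h (Real.sqrt_le_sqrt (by nlinarith)) (h0.trans h.le) (Real.sqrt_pos.2 h1)

lemma continuousAt_errorLevel {E : ℝ} (h0 : 0 ≤ E) (h2 : E < 2) : ContinuousAt errorLevel E := by
  refine ContinuousAt.div continuousAt_id ?_ (Real.sqrt_pos.2 (four_sub_sq_pos h0 h2)).ne'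
  fun_prop

lemma exists_errorLevel_eq {τ : ℝ} (hτ : 0 ≤ τ) : ∃ E, 0 ≤ E ∧ E < 2 ∧ errorLevel E = τ := by
  have hs : 0 < √(1 + τ ^ 2) := Real.sqrt_pos.2 (by positivity)
  have hsq : √(1 + τ ^ 2) ^ 2 = 1 + τ ^ 2 := Real.sq_sqrt (by positivity)
  -- This is `2 sin (arctan τ)`.
  refine ⟨2 * τ / √(1 + τ ^ 2), by positivity, ?_, ?_⟩
  · rw [div_lt_iff₀ hs]
    have : τ < √(1 + τ ^ 2) := Real.lt_sqrt_of_sq_lt (by linarith)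
    linarith
  · have : 4 - (2 * τ / √(1 + τ ^ 2)) ^ 2 = (2 / √(1 + τ ^ 2)) ^ 2 := by
      rw [div_pow, div_pow, hsq]; field_simp; ring
    rw [errorLevel, this, Real.sqrt_sq (by positivity)]
    field_simp

/-- Translation of the error bound into a bound on the tangent of half the phase error. -/
lemma two_mul_abs_im_div_le_iff {E : ℝ} (h0 : 0 ≤ E) (h2 : E < 2) {u : ℂ} (hu : u ≠ 0) :
    2 * |u.im| / ‖u‖ ≤ E ↔ |u.im| ≤ errorLevel E * |u.re| := by
  have hE := four_sub_sq_pos h0 h2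
  have hs := Real.sqrt_pos.2 hE
  rw [div_le_iff₀ (norm_pos_iff.2 hu), errorLevel, div_mul_eq_mul_div, le_div_iff₀ hs,
    ← sq_le_sq₀ (show 0 ≤ 2 * |u.im| by positivity) (by positivity),
    ← sq_le_sq₀ (show 0 ≤ |u.im| * √(4 - E ^ 2) by positivity) (by positivity)]
  simp only [mul_pow, sq_abs, Real.sq_sqrt hE.le, Complex.sq_norm, Complex.normSq_apply]
  constructor <;> intro h <;> nlinarith

/-- The sign ambiguity in `Q` is harmless, since `Q` and `-Q` have the same conjugate quotient. -/
lemma exists_errorCone_of_expError_le {n : ℕ} {ω E : ℝ} (h0 : 0 ≤ E) (h2 : E < 2)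
    {r : RatFunc ℂ} (hr : r ∈ unitaryClass n) (h : expError ω r ≤ E) :
    ∃ Q : ℂ[X], Q.natDegree ≤ n ∧ (∀ x : ℝ, Q.eval (x : ℂ) ≠ 0) ∧
      (∀ x : ℝ, ratVal r (Complex.I * x) = starRingEnd ℂ (Q.eval (x : ℂ)) / Q.eval (x : ℂ)) ∧
      ErrorCone ω (errorLevel E) Q := by
  obtain ⟨Q, hn, hQ, hval⟩ := exists_conj_div_of_mem hr
  have h1 : ∀ x ∈ Set.Icc (-1 : ℝ) 1,
      |(rotVal ω Q x).im| ≤ errorLevel E * |(rotVal ω Q x).re| := by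
    intro x hx
    rw [← two_mul_abs_im_div_le_iff h0 h2 (mt rotVal_eq_zero_iff.1 (hQ x)), norm_rotVal,
      ← norm_conj_div_sub_exp ω (hQ x), ← hval]
    exact (norm_sub_exp_le_expError hr.2 ω hx).trans h
  rcases errorCone_or_errorCone_neg hQ h1 with hc | hc
  · exact ⟨Q, hn, hQ, hval, hc⟩
  · exact ⟨-Q, by rwa [natDegree_neg], by simpa using hQ, by simpa using hval, hc⟩

lemma expError_le_of_errorCone {ω E : ℝ} (h0 : 0 ≤ E) (h2 : E < 2) {r : RatFunc ℂ} {Q : ℂ[X]}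
    (hQ : ∀ x : ℝ, Q.eval (x : ℂ) ≠ 0)
    (hval : ∀ x : ℝ, ratVal r (Complex.I * x) = starRingEnd ℂ (Q.eval (x : ℂ)) / Q.eval (x : ℂ))
    (hc : ErrorCone ω (errorLevel E) Q) : expError ω r ≤ E := by
  refine imagNorm_le fun x hx => ?_
  rw [hval, norm_conj_div_sub_exp ω (hQ x), ← norm_rotVal ω,
    two_mul_abs_im_div_le_iff h0 h2 (mt rotVal_eq_zero_iff.1 (hQ x))]
  exact (hc x hx).trans (mul_le_mul_of_nonneg_left (le_abs_self _) (errorLevel_nonneg h0))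

/-! ### Best approximation and convergence -/

theorem mainTheorem3 (n : ℕ) (ω : ℝ) (hω : ω ∈ Set.Ioo (0 : ℝ) (((n : ℝ) + 1) * Real.pi)) :
    (∃! rt : RatFunc ℂ, IsUnitaryBestApproximant n ω rt) ∧
    ∀ rt : RatFunc ℂ, IsUnitaryBestApproximant n ω rt →
      ∀ r : ℕ → RatFunc ℂ, (∀ j, r j ∈ unitaryClass n) →
        Tendsto (fun j => expError ω (r j)) atTop (𝓝 (expError ω rt)) →
          Tendsto (fun j => imagNorm (fun z => ratVal (r j) z - ratVal rt z)) atTop (𝓝 0) := by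
  have hω0 : ω ≠ 0 := hω.1.ne'
  obtain ⟨Q₁, hQ₁n, hQ₁⟩ := exists_rotVal_re_pos n hω.1 hω.2
  have hQ₁0 : Q₁ ≠ 0 := by
    rintro rfl
    simpa [rotVal] using hQ₁ 0 (by norm_num)
  obtain ⟨y, hy, hcone₁⟩ := exists_errorCone_attained hQ₁
  obtain ⟨τ, hτ0, hmin, Q, hQ, hQn, hcone⟩ := exists_isMinimalLevel
    (div_nonneg (abs_nonneg _) (hQ₁ y hy).le) hQ₁0 hQ₁n hcone₁
  have hτ : 0 < τ := by
    refine lt_of_le_of_ne hτ0 ?_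
    rintro rfl
    exact hQ (eq_zero_of_errorCone_zero hω0 hcone)
  have hQx := eval_ne_zero_of_isCoprime (isCoprime_of_isMinimalLevel hω0 hτ hmin hQ hQn hcone).1
  obtain ⟨r₀, hr₀, hval₀⟩ := exists_mem_of_conj_div hQn hQx
  obtain ⟨e, he0, he2, rfl⟩ := exists_errorLevel_eq hτ0
  have hr₀e : expError ω r₀ ≤ e := expError_le_of_errorCone he0 he2 hQx hval₀ hcone
  have hne : ∀ {P : ℂ[X]}, (∀ x : ℝ, P.eval (x : ℂ) ≠ 0) → P ≠ 0 := by
    rintro P hP rfl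
    simpa using hP 0
  have hbest : IsUnitaryBestApproximant n ω r₀ := by
    refine ⟨hr₀, fun s hs => ?_⟩
    by_contra! hlt
    have hs0 : 0 ≤ expError ω s := imagNorm_nonneg _
    have hse := hlt.trans_le hr₀e
    obtain ⟨P, hPn, hP, -, hPc⟩ :=
      exists_errorCone_of_expError_le hs0 (hse.trans he2) hs le_rfl
    exact hne hP (hmin _ (errorLevel_nonneg hs0) (errorLevel_lt hs0 hse he2) P hPn hPc)
  have huniq : ∀ r, IsUnitaryBestApproximant n ω r → r = r₀ := by
    rintro r ⟨hr, hrb⟩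
    obtain ⟨P, hPn, hP, hval, hPc⟩ :=
      exists_errorCone_of_expError_le he0 he2 hr ((hrb r₀ hr₀).trans hr₀e)
    obtain ⟨c, hc⟩ := eq_C_mul_of_isMinimalLevel hω0 hτ hmin hQ (hne hP) hQn hPn hcone hPc
    refine eq_of_ratVal_eq hr.2 hr₀.2 fun x => ?_
    rw [hval, hval₀, div_eq_div_iff (hP x) (hQx x), hc, eval_mul, eval_C, map_mul,
      Complex.conj_ofReal]
    ring
  refine ⟨⟨r₀, hbest, huniq⟩, fun rt hrt r hr hlim => ?_⟩
  rw [huniq rt hrt] at hlim ⊢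
  rw [Metric.tendsto_nhds]
  intro η hη
  -- Pointwise strict bounds pass to the supremum only as `≤`, hence `η / 2`.
  obtain ⟨δ, hδ, hclose⟩ :=
    exists_delta_of_isMinimalLevel hω0 hτ hmin hQ hQn hcone (half_pos hη)
  obtain ⟨E, hE, hE2, hEδ⟩ : ∃ E, e < E ∧ E < 2 ∧ errorLevel E < errorLevel e + δ := by
    have h1 : ∀ᶠ E in 𝓝[>] e, errorLevel E < errorLevel e + δ :=
      nhdsWithin_le_nhds ((continuousAt_errorLevel he0 he2).eventually_lt_const
        (lt_add_of_pos_right _ hδ))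
    obtain ⟨E, h2, h3⟩ := (h1.and (Ioo_mem_nhdsGT he2)).exists
    exact ⟨E, h3.1, h3.2, h2⟩
  have hE0 : 0 ≤ E := he0.trans hE.le
  filter_upwards [hlim.eventually_lt_const (hr₀e.trans_lt hE)] with j hj
  obtain ⟨P, hPn, hP, hval, hPc⟩ := exists_errorCone_of_expError_le hE0 hE2 (hr j) hj.le
  rw [Real.dist_eq, sub_zero, abs_of_nonneg (imagNorm_nonneg _)]
  refine (imagNorm_le fun x hx => ?_).trans_lt (half_lt_self hη)
  have h1 := hclose _ (errorLevel_nonneg hE0) hEδ P (hne hP) hPn hPc x hx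
  rw [hval, hval₀, div_sub_div _ _ (hP x) (hQx x), norm_div, norm_mul,
    div_le_iff₀ (mul_pos (norm_pos_iff.2 (hP x)) (norm_pos_iff.2 (hQx x))),
    mul_comm (P.eval (x : ℂ))]
  exact h1.le
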